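/- Let $H$ be a complex Hilbert space, $a=a^*\in B(H)$ a bounded self-adjoint operator with spectrum $\sigma(a)\subset\mathbb R$, and $\omega$ a state on $B(H)$ (a positive linear functional with $\omega(1_H)=1$). Let $\mu_a$ be the Born measure, i.e. the unique probability measure on $\sigma(a)$ with $\omega(g(a))=\int_{\sigma(a)} g\,d\mu_a$ for all continuous $g$ on $\sigma(a)$. Suppose that $(a,\omega)$ describes a fair quantum coin flip: $\sigma(a)$ has exactly two points and $\mu_a(\{\lambda\})=1/2$ for each $\lambda\in\sigma(a)$. Label the two outcomes by $0$ and $1$ (in either way), so that an infinite outcome sequence $x\in\sigma(a)^{\mathbb N}$ becomes a binary sequence. Let $\mu_a^\infty$ be the infinite product measure on $\sigma(a)^{\mathbb N}$ induced by $\mu_a$. Then for $\mu_a^\infty$-almost every $x\in\sigma(a)^{\mathbb N}$, the corresponding binary sequence is $1$-random, and also Borel normal, incomputable, and contains every finite binary string infinitely often. Here, writing $N(s)\subset\{0,1\}^{\mathbb N}$ for the set of sequences that start with the finite string $s$, and $\mu^\infty$ for the 50-50 product measure on $\{0,1\}^{\mathbb N}$: * $y\in\{0,1\}^{\mathbb N}$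 is *$1$-random* (Martin-Löf random) if $y\notin\bigcap_n U_n$ for every Martin-Löf test, that is, for every partial computable $\sigma:\mathbb N\times\mathbb N\to\{0,1\}^*$ such that the sets $U_n=\bigcup_m N(\sigma(n,m))$ (the union being over those $m$ for which $\sigma(n,m)$ is defined) satisfy $U_{n+1}\subseteq U_n$ and $\mu^\infty(U_n)\le 2^{-n}$ for all $n$; * $y$ is *Borel normal* if every finite string $s$ occurs in $y$ with asymptotic relative frequency $2^{-|s|}$, i.e. $\frac1N\#\{i<N : s \text{ occurs in } y \text{ at position } i\}\to 2^{-|s|}$ as $N\to\infty$; * $y$ is *incomputable* if the function $n\mapsto y_n$ is not computable. -/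

import Mathlib

open MeasureTheory Filter Topology

noncomputable section

namespace QuantumCoin

/-! ### States and the Born measure -/

/-- A state on the C⋆-algebra `B(H)` of bounded operators on a Hilbert space `H`: a linear
functional `ω : B(H) → ℂ` which is positive, `ω (b⋆ b) ∈ [0, ∞)` for all `b`, and normalised,
`ω 1 = 1`. -/
structure State (H : Type*) [NormedAddCommGroup H] [InnerProductSpace ℂ H] [CompleteSpace H] where
  /-- the underlying linear functional -/
  toLinearMap : (H →L[ℂ] H) →ₗ[ℂ] ℂ
  re_nonneg : ∀ b : H →L[ℂ] H, 0 ≤ (toLinearMap (star b * b)).re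
  im_eq_zero : ∀ b : H →L[ℂ] H, (toLinearMap (star b * b)).im = 0
  map_one : toLinearMap 1 = 1

section Born

variable {H : Type*} [NormedAddCommGroup H] [InnerProductSpace ℂ H] [CompleteSpace H]

/-- The state on `C(σ(a))` obtained by restricting `ω` to `C⋆(a)` and transporting it along the
continuous functional calculus `g ↦ g(a)`, as a positive linear functional on real-valued
functions (the spectrum of the self-adjoint operator `a` is a compact subset of `ℝ`, so that
all continuous functions on it have compact support). -/
def State.functional (ω : State H) (a : H →L[ℂ] H) (ha : IsSelfAdjoint a) :
    CompactlySupportedContinuousMap (spectrum ℝ a) ℝ →ₚ[ℝ] ℝ :=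
  PositiveLinearMap.mk₀
    { toFun := fun g => (ω.toLinearMap (cfcHom (R := ℝ) ha (g : C(spectrum ℝ a, ℝ)))).re
      map_add' := fun f g => by
        have : ((f + g : CompactlySupportedContinuousMap (spectrum ℝ a) ℝ) :
            C(spectrum ℝ a, ℝ)) = (f : C(spectrum ℝ a, ℝ)) + (g : C(spectrum ℝ a, ℝ)) := rfl
        rw [this]
        simp
      map_smul' := fun c f => by
        have : ((c • f : CompactlySupportedContinuousMap (spectrum ℝ a) ℝ) :
            C(spectrum ℝ a, ℝ)) = c • (f : C(spectrum ℝ a, ℝ)) := rfl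
        rw [this, map_smul, ← Complex.coe_smul, map_smul]
        simp }
    (fun f hf => by
      let g : C(spectrum ℝ a, ℝ) := ⟨fun x => Real.sqrt (f x), by fun_prop⟩
      have hg : (f : C(spectrum ℝ a, ℝ)) = star g * g := by
        ext x
        exact (Real.mul_self_sqrt (hf x)).symm
      change 0 ≤ (ω.toLinearMap (cfcHom (R := ℝ) ha (f : C(spectrum ℝ a, ℝ)))).re
      rw [hg, map_mul, map_star]
      exact ω.re_nonneg _)

/-- The Born measure `μ_a` of the self-adjoint operator `a` in the state `ω`: the measure on the
spectrum `σ(a)` that represents, by the Riesz representation theorem, the functional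
`g ↦ ω (g(a))`. -/
def bornMeasure (ω : State H) (a : H →L[ℂ] H) (ha : IsSelfAdjoint a) :
    Measure (spectrum ℝ a) :=
  RealRMK.rieszMeasure (ω.functional a ha)

/-- The Born rule `∫ g dμ_a = ω (g(a))`. -/
theorem integral_bornMeasure (ω : State H) (a : H →L[ℂ] H) (ha : IsSelfAdjoint a)
    (g : C(spectrum ℝ a, ℝ)) :
    ∫ x, g x ∂(bornMeasure ω a ha) = (ω.toLinearMap (cfcHom (R := ℝ) ha g)).re :=
  RealRMK.integral_rieszMeasure (ω.functional a ha)
    (CompactlySupportedContinuousMap.continuousMapEquiv g)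

instance (ω : State H) (a : H →L[ℂ] H) (ha : IsSelfAdjoint a) :
    IsProbabilityMeasure (bornMeasure ω a ha) := by
  have h := integral_bornMeasure ω a ha 1
  rw [map_one, ω.map_one] at h
  have h' : (bornMeasure ω a ha).real Set.univ = 1 := by simpa using h
  constructor
  rw [Measure.real, ENNReal.toReal_eq_one_iff] at h'
  exact h'

end Born

/-! ### 1-randomness of binary sequences

Strings are elements of `List Bool`, sequences are functions `ℕ → Bool`, with `false` and `true`
standing for the digits `0` and `1`. -/

/-- The string of length `n` that starts at position `i` of the sequence `x`. -/
def block (x : ℕ → Bool) (i n : ℕ) : List Bool :=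
  List.ofFn fun k : Fin n => x (i + k)

/-- The set `N(s)` of all sequences that start with the string `s`. -/
def cylinder (s : List Bool) : Set (ℕ → Bool) :=
  {x | block x 0 s.length = s}

/-- The probability measure on `{0, 1}^ℕ` induced by the 50-50 measure on `{0, 1}`. -/
def coinMeasure : Measure (ℕ → Bool) :=
  Measure.infinitePi fun _ : ℕ => (PMF.uniformOfFintype Bool).toMeasure

/-- The open set `U n = ⋃ₘ N(σ(n, m))` defined by a partial function `σ` with values in the set of
strings; the union is over those `m` for which `σ(n, m)` is defined. -/
def openOf (σ : ℕ → ℕ →. List Bool) (n : ℕ) : Set (ℕ → Bool) :=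
  {x | ∃ m, ∃ s ∈ σ n m, x ∈ cylinder s}

/-- `σ` is (an enumeration of) a Martin-Löf test: it is partial computable and the sets
`U n = ⋃ₘ N(σ(n, m))` decrease and satisfy `μ^∞(U n) ≤ 2⁻ⁿ`. -/
structure IsMartinLofTest (σ : ℕ → ℕ →. List Bool) : Prop where
  partrec : Partrec₂ σ
  anti : ∀ n, openOf σ (n + 1) ⊆ openOf σ n
  measure_le : ∀ n, coinMeasure (openOf σ n) ≤ (2 : ENNReal)⁻¹ ^ n

/-- A binary sequence is 1-random (Martin-Löf random) if it does not belong to the effective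
measure zero set `⋂ₙ U n` of any Martin-Löf test. -/
def OneRandom (x : ℕ → Bool) : Prop :=
  ∀ σ : ℕ → ℕ →. List Bool, IsMartinLofTest σ → x ∉ ⋂ n, openOf σ n

/-! ### Consequences of 1-randomness -/

/-- A binary sequence is Borel normal if every string `s` occurs in it with asymptotic relative
frequency `2 ^ (-|s|)`. -/
def BorelNormal (x : ℕ → Bool) : Prop :=
  ∀ s : List Bool,
    Tendsto (fun N : ℕ =>
        (((Finset.range N).filter fun i => block x i s.length = s).card : ℝ) / (N : ℝ))
      atTop (𝓝 ((1 / 2 : ℝ) ^ s.length))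

/-- Every finite string occurs at infinitely many positions of the sequence. -/
def ContainsAllInfinitelyOften (x : ℕ → Bool) : Prop :=
  ∀ s : List Bool, {i : ℕ | block x i s.length = s}.Infinite

end QuantumCoin

end

open ProbabilityTheory

namespace QuantumCoin

/-! ### Countability of the sets of partial computable and computable functions -/

/-! Fairness makes the labelling push the product of Born measures forward to `coinMeasure`
(`map_infinitePi_eq_coinMeasure`), so only fair coin flips matter. There are countably many partial
computable functions, hence countably many tests, each capturing a null set; likewise there are
countably many computable sequences, and points are null. Normality is not deduced from 1-randomness
but from the strong law of large numbers: along positions in one residue class modulo `|s|`,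
occurrences of `s` read disjoint windows, so they are i.i.d. with mean `2 ^ (-|s|)`.
`tendsto_average_of_residues` merges the classes. Normality in turn forces infinitely many
occurrences, since finitely many would have frequency zero. -/

theorem countable_setOf_partrec (α β : Type*) [Primcodable α] [Primcodable β] :
    {f : α →. β | Partrec f}.Countable := by
  have hcode : {g : ℕ →. ℕ | Nat.Partrec g}.Countable := by
    refine (Set.countable_range Nat.Partrec.Code.eval).mono fun g hg => ?_
    exact Nat.Partrec.Code.exists_code.1 hg
  -- `Partrec f` unfolds to `Nat.Partrec` of this transported function, and evaluating it at codes
  -- of elements of `α` recovers `f`.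
  refine Set.MapsTo.countable_of_injOn (s := {f : α →. β | Partrec f})
    (t := {g : ℕ →. ℕ | Nat.Partrec g})
    (f := fun f n => Part.bind (Part.ofOption (Encodable.decode (α := α) n)) fun a =>
      (f a).map Encodable.encode)
    (fun f hf => hf) (fun f _ g _ h => ?_) hcode
  funext a
  have h' := congrFun h (Encodable.encode a)
  simp only [Encodable.encodek, Part.coe_some, Part.bind_some] at h'
  ext b
  have hb : Encodable.encode b ∈ (f a).map Encodable.encode ↔
      Encodable.encode b ∈ (g a).map Encodable.encode := by rw [h']
  simpa [Part.mem_map_iff, Encodable.encode_inj] using hb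

theorem countable_setOf_partrec₂ (α β γ : Type*) [Primcodable α] [Primcodable β]
    [Primcodable γ] : {f : α → β →. γ | Partrec₂ f}.Countable := by
  refine Set.MapsTo.countable_of_injOn (f := fun f (p : α × β) => f p.1 p.2) (fun f hf => hf)
    (fun f _ g _ h => ?_) (countable_setOf_partrec (α × β) γ)
  funext a b
  exact congrFun h (a, b)

theorem countable_setOf_computable (α β : Type*) [Primcodable α] [Primcodable β] :
    {f : α → β | Computable f}.Countable := by
  refine Set.MapsTo.countable_of_injOn (f := fun f => (f : α →. β)) (fun f hf => hf)
    (fun f _ g _ h => ?_) (countable_setOf_partrec α β)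
  funext a
  exact Part.some_injective (congrFun h a)

/-! ### The coin measure -/

instance : IsProbabilityMeasure coinMeasure := by
  unfold coinMeasure
  infer_instance

theorem uniform_bool_singleton (b : Bool) :
    (PMF.uniformOfFintype Bool).toMeasure {b} = 2⁻¹ := by
  rw [PMF.toMeasure_apply_singleton _ _ (measurableSet_singleton b)]
  simp

theorem block_eq_iff (x : ℕ → Bool) (i : ℕ) (s : List Bool) :
    block x i s.length = s ↔ ∀ k (hk : k < s.length), x (i + k) = s[k] := by
  unfold block
  constructor
  · intro h k hk
    have := List.getElem_of_eq h.symm hk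
    simpa using this.symm
  · intro h
    refine List.ext_getElem (by simp) fun k hk hk' => ?_
    simpa using h k hk'

theorem cylinder_eq_pi (s : List Bool) :
    cylinder s = Set.pi (Finset.range s.length : Set ℕ) fun k => {s.getD k false} := by
  ext x
  simp only [cylinder, Set.mem_ofPred_eq, block_eq_iff, Set.mem_pi, Finset.coe_range, Set.mem_Iio,
    Set.mem_singleton_iff, zero_add]
  refine forall_congr' fun k => forall_congr' fun hk => ?_
  rw [List.getD_eq_getElem _ _ hk]

theorem measurableSet_cylinder (s : List Bool) : MeasurableSet (cylinder s) := by
  rw [cylinder_eq_pi]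
  exact MeasurableSet.pi (Finset.countable_toSet _) fun _ _ => measurableSet_singleton _

theorem coinMeasure_cylinder (s : List Bool) :
    coinMeasure (cylinder s) = (2 : ENNReal)⁻¹ ^ s.length := by
  rw [cylinder_eq_pi, coinMeasure, Measure.infinitePi_pi _ fun _ _ => measurableSet_singleton _]
  simp only [uniform_bool_singleton, Finset.prod_const, Finset.card_range]

/-- The point lies in the cylinder of each of its prefixes. -/
theorem coinMeasure_singleton (x : ℕ → Bool) : coinMeasure {x} = 0 := by
  have hle : ∀ n : ℕ, coinMeasure {x} ≤ (2 : ENNReal)⁻¹ ^ n := fun n => by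
    have := coinMeasure_cylinder (block x 0 n)
    rw [show (block x 0 n).length = n by simp [block]] at this
    rw [← this]
    refine measure_mono (Set.singleton_subset_iff.2 ?_)
    change block x 0 (List.length (List.ofFn _)) = _
    rw [List.length_ofFn]
  exact le_antisymm (ge_of_tendsto'
    (ENNReal.tendsto_pow_atTop_nhds_zero_of_lt_one (by simp)) hle) zero_le

instance : NullSingletonClass coinMeasure := ⟨coinMeasure_singleton⟩

/-! ### 1-randomness and incomputability -/

theorem IsMartinLofTest.measure_iInter_eq_zero {σ : ℕ → ℕ →. List Bool}
    (hσ : IsMartinLofTest σ) : coinMeasure (⋂ n, openOf σ n) = 0 :=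
  le_antisymm (ge_of_tendsto' (ENNReal.tendsto_pow_atTop_nhds_zero_of_lt_one (by simp))
    fun n => (measure_mono (Set.iInter_subset _ n)).trans (hσ.measure_le n)) zero_le

theorem ae_oneRandom : ∀ᵐ x ∂coinMeasure, OneRandom x := by
  have hc : {σ | IsMartinLofTest σ}.Countable :=
    (countable_setOf_partrec₂ ℕ ℕ (List Bool)).mono fun σ hσ => hσ.partrec
  have h := (ae_ball_iff (μ := coinMeasure) (p := fun x σ _ => x ∉ ⋂ n, openOf σ n) hc).2
    fun σ hσ => measure_eq_zero_iff_ae_notMem.1 (IsMartinLofTest.measure_iInter_eq_zero hσ)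
  exact h

theorem ae_not_computable : ∀ᵐ x ∂coinMeasure, ¬ Computable x :=
  measure_eq_zero_iff_ae_notMem.1 ((countable_setOf_computable ℕ Bool).measure_zero coinMeasure)

/-! ### Borel normality -/

/-- Cesàro convergence of a bounded sequence follows from Cesàro convergence along each residue
class. -/
theorem tendsto_average_of_residues {f : ℕ → ℝ} {c C : ℝ} {L : ℕ} (hL : 0 < L)
    (hf : ∀ i, |f i| ≤ C)
    (h : ∀ r < L, Tendsto (fun n : ℕ => (∑ j ∈ Finset.range n, f (j * L + r)) / n) atTop (𝓝 c)) :
    Tendsto (fun n : ℕ => (∑ i ∈ Finset.range n, f i) / n) atTop (𝓝 c) := by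
  have hLR : (L : ℝ) ≠ 0 := by positivity
  have hblocks : ∀ q, ∑ i ∈ Finset.range (q * L), f i =
      ∑ r ∈ Finset.range L, ∑ j ∈ Finset.range q, f (j * L + r) := fun q => by
    induction q with
    | zero => simp
    | succ q ih => simp [Finset.sum_range_succ, Finset.sum_add_distrib, ← ih, add_mul,
        Finset.sum_range_add]
  have hmul : Tendsto (fun q : ℕ => (∑ i ∈ Finset.range (q * L), f i) / q) atTop
      (𝓝 (L * c)) := by
    have := tendsto_finsetSum (Finset.range L) fun r hr => h r (Finset.mem_range.1 hr)
    simpa [hblocks, Finset.sum_div] using this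
  have hdiv : Tendsto (fun n : ℕ => n / L) atTop atTop := Nat.tendsto_div_const_atTop hL.ne'
  have hquot : Tendsto (fun n : ℕ => ((n / L : ℕ) : ℝ) / n) atTop (𝓝 (1 / L)) := by
    have := (tendsto_nat_floor_mul_div_atTop (R := ℝ) (a := 1 / L) (by positivity)).comp
      tendsto_natCast_atTop_atTop
    refine this.congr fun n => ?_
    simp only [Function.comp_apply]
    rw [one_div_mul_eq_div, Nat.floor_div_eq_div]
  -- The incomplete last block has fewer than `L` terms, each at most `C` in absolute value.
  have herr : Tendsto (fun n : ℕ => (∑ i ∈ Finset.range (n % L), f (n / L * L + i)) / n) atTop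
      (𝓝 0) := by
    refine squeeze_zero_norm (fun n => ?_)
      (tendsto_const_nhds (x := L * C) |>.div_atTop tendsto_natCast_atTop_atTop)
    have hC : 0 ≤ C := (abs_nonneg _).trans (hf 0)
    rw [Real.norm_eq_abs, abs_div, Nat.abs_cast]
    gcongr
    refine (Finset.abs_sum_le_sum_abs _ _).trans ((Finset.sum_le_sum fun i _ => hf _).trans ?_)
    simp only [Finset.sum_const, Finset.card_range, nsmul_eq_mul]
    gcongr
    exact (Nat.mod_lt n hL).le
  have hmain := ((hmul.comp hdiv).mul hquot).add herr
  rw [show (L : ℝ) * c * (1 / L) + 0 = c by field_simp; ring] at hmain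
  refine hmain.congr' ?_
  filter_upwards [eventually_ge_atTop L] with n hn
  have hq : ((n / L : ℕ) : ℝ) ≠ 0 := by
    exact_mod_cast (Nat.div_pos hn hL).ne'
  simp only [Function.comp_apply]
  rw [div_mul_div_cancel₀ hq, ← add_div, ← Finset.sum_range_add, Nat.div_add_mod']

/-- The indicator of the occurrence of `s` at position `i` of the sequence `x`. -/
noncomputable def occurrence (s : List Bool) (i : ℕ) (x : ℕ → Bool) : ℝ :=
  if block x i s.length = s then 1 else 0

theorem occurrence_zero (s : List Bool) : occurrence s 0 = (cylinder s).indicator 1 := by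
  ext x
  by_cases h : block x 0 s.length = s <;> simp [occurrence, Set.indicator, cylinder, h]

theorem measurable_occurrence_zero (s : List Bool) : Measurable (occurrence s 0) := by
  rw [occurrence_zero]
  exact measurable_one.indicator (measurableSet_cylinder s)

theorem abs_occurrence_le (s : List Bool) (i : ℕ) (x : ℕ → Bool) : |occurrence s i x| ≤ 1 := by
  unfold occurrence
  split_ifs <;> simp

/-- The shift selects distinct coordinates of an i.i.d. family. -/
theorem measurePreserving_shift (i : ℕ) :
    MeasurePreserving (fun (x : ℕ → Bool) k => x (i + k)) coinMeasure coinMeasure := by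
  refine ⟨by fun_prop, ?_⟩
  exact Measure.map_infinitePi_infinitePi_of_inj (f := fun k => i + k)
    (add_right_injective i)

theorem occurrence_eq_comp_shift (s : List Bool) (i : ℕ) :
    occurrence s i = occurrence s 0 ∘ fun x k => x (i + k) := by
  ext x
  have h : block (fun k => x (i + k)) 0 s.length = block x i s.length := by simp [block]
  simp only [occurrence, Function.comp_apply, h]

theorem identDistrib_occurrence (s : List Bool) (i j : ℕ) :
    IdentDistrib (occurrence s i) (occurrence s j) coinMeasure coinMeasure := by
  have hz : ∀ i, IdentDistrib (occurrence s i) (occurrence s 0) coinMeasure coinMeasure := by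
    intro i
    have hm := measurable_occurrence_zero s
    rw [occurrence_eq_comp_shift s i]
    refine ⟨(hm.comp (measurePreserving_shift i).measurable).aemeasurable, hm.aemeasurable, ?_⟩
    rw [← Measure.map_map hm (measurePreserving_shift i).measurable,
      (measurePreserving_shift i).map_eq]
  exact (hz i).trans (hz j).symm

theorem integral_occurrence (s : List Bool) (i : ℕ) :
    ∫ x, occurrence s i x ∂coinMeasure = (1 / 2 : ℝ) ^ s.length := by
  rw [(identDistrib_occurrence s i 0).integral_eq, occurrence_zero,
    integral_indicator_one (measurableSet_cylinder s), Measure.real, coinMeasure_cylinder]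
  simp

theorem indepFun_occurrence (s : List Bool) {i j : ℕ} (hij : i + s.length ≤ j) :
    IndepFun (occurrence s i) (occurrence s j) coinMeasure := by
  have hI : iIndepFun (fun k (x : ℕ → Bool) => x k) coinMeasure :=
    iIndepFun_infinitePi (X := fun _ b => b) fun _ => measurable_id
  -- An occurrence depends only on its window of coordinates; `hij` makes the two windows disjoint.
  have hfac : ∀ i, ∃ φ : (Finset.Ico i (i + s.length) → Bool) → ℝ,
      occurrence s i = φ ∘ fun x k => x k := fun i =>
    ⟨fun y => if (List.ofFn fun k : Fin s.length => y ⟨i + k, by simp⟩) = s then 1 else 0, rfl⟩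
  obtain ⟨φ, hφ⟩ := hfac i
  obtain ⟨ψ, hψ⟩ := hfac j
  rw [hφ, hψ]
  refine (hI.indepFun_finset (Finset.Ico i (i + s.length)) (Finset.Ico j (j + s.length)) ?_
    fun k => measurable_pi_apply k).comp (measurable_of_finite φ) (measurable_of_finite ψ)
  exact Finset.disjoint_left.2 fun k hk hk' => by
    simp only [Finset.mem_Ico] at hk hk'
    omega

theorem ae_tendsto_average_occurrence (s : List Bool) (r : ℕ) :
    ∀ᵐ x ∂coinMeasure, Tendsto
      (fun n : ℕ => (∑ j ∈ Finset.range n, occurrence s (j * s.length + r) x) / n) atTop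
      (𝓝 ((1 / 2 : ℝ) ^ s.length)) := by
  have hmeas : AEStronglyMeasurable (occurrence s (0 * s.length + r)) coinMeasure :=
    (identDistrib_occurrence s _ 0).aemeasurable_fst.aestronglyMeasurable
  have hlt : ∀ i j, i < j → IndepFun (occurrence s (i * s.length + r))
      (occurrence s (j * s.length + r)) coinMeasure := fun i j hij =>
    indepFun_occurrence s (by nlinarith)
  have := strong_law_ae_real (fun j => occurrence s (j * s.length + r)) (μ := coinMeasure)
    (.of_bound hmeas 1 (ae_of_all _ (abs_occurrence_le s _)))
    (fun i j hij => hij.lt_or_gt.elim (hlt i j) fun h => (hlt j i h).symm)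
    fun i => identDistrib_occurrence s _ _
  rwa [integral_occurrence] at this

theorem ae_borelNormal : ∀ᵐ x ∂coinMeasure, BorelNormal x := by
  refine ae_all_iff.2 fun s => ?_
  have hcard : ∀ x (N : ℕ), (((Finset.range N).filter fun i => block x i s.length = s).card : ℝ) =
      ∑ i ∈ Finset.range N, occurrence s i x := fun x N => by
    simp only [occurrence, Finset.sum_boole]
  simp only [hcard]
  -- The empty string has no residue classes to split into; its frequency is 1 as soon as `N ≠ 0`.
  rcases Nat.eq_zero_or_pos s.length with hs | hs
  · refine ae_of_all _ fun x => ?_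
    obtain rfl := List.eq_nil_of_length_eq_zero hs
    refine tendsto_const_nhds.congr' ?_
    filter_upwards [eventually_ne_atTop 0] with N hN
    simp [occurrence, block, hN]
  · filter_upwards [ae_all_iff.2 fun r => ae_tendsto_average_occurrence s r] with x hx
    exact tendsto_average_of_residues hs (fun i => abs_occurrence_le s i x) fun r _ => hx r

theorem BorelNormal.containsAllInfinitelyOften {x : ℕ → Bool} (hx : BorelNormal x) :
    ContainsAllInfinitelyOften x := by
  intro s hfin
  have hz : Tendsto (fun N : ℕ =>
      (((Finset.range N).filter fun i => block x i s.length = s).card : ℝ) / (N : ℝ))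
      atTop (𝓝 0) := by
    refine squeeze_zero (fun N => by positivity) (fun N => ?_)
      (tendsto_const_nhds (x := (hfin.toFinset.card : ℝ)) |>.div_atTop
        tendsto_natCast_atTop_atTop)
    gcongr
    intro i hi
    simpa using (Finset.mem_filter.1 hi).2
  exact (pow_pos (by norm_num : (0 : ℝ) < 1 / 2) s.length).ne' (tendsto_nhds_unique (hx s) hz)

/-! ### Transfer to the outcome space -/

theorem map_infinitePi_eq_coinMeasure {X : Type*} [MeasurableSpace X]
    [MeasurableSingletonClass X] (μ : Measure X) [IsProbabilityMeasure μ] (e : X ≃ Bool)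
    (hfair : ∀ l, μ {l} = 1 / 2) :
    (Measure.infinitePi fun _ : ℕ => μ).map (fun x n => e (x n)) = coinMeasure := by
  -- Countability with measurable singletons makes `e` measurable and lets point masses determine
  -- the pushforward.
  have : Countable X := e.injective.countable
  have he : Measurable e := measurable_of_countable _
  have hμ : μ.map e = (PMF.uniformOfFintype Bool).toMeasure := by
    refine Measure.ext_of_singleton fun b => ?_
    rw [uniform_bool_singleton, Measure.map_apply he (measurableSet_singleton b),
      ← e.image_symm_eq_preimage, Set.image_singleton, hfair, one_div]
  rw [coinMeasure, ← hμ]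
  exact Measure.infinitePi_map_pi _ fun _ => he

end QuantumCoin

theorem corollary4p2 {H : Type*} [NormedAddCommGroup H] [InnerProductSpace ℂ H] [CompleteSpace H]
    (ω : QuantumCoin.State H) (a : H →L[ℂ] H) (ha : IsSelfAdjoint a)
    (e : spectrum ℝ a ≃ Bool)
    (hfair : ∀ l : spectrum ℝ a, QuantumCoin.bornMeasure ω a ha {l} = 1 / 2) :
    ∀ᵐ x ∂(Measure.infinitePi fun _ : ℕ => QuantumCoin.bornMeasure ω a ha),
      QuantumCoin.OneRandom (fun n => e (x n)) ∧
      QuantumCoin.BorelNormal (fun n => e (x n)) ∧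
      ¬ Computable (fun n => e (x n)) ∧
      QuantumCoin.ContainsAllInfinitelyOften (fun n => e (x n)) := by
  have hmap := QuantumCoin.map_infinitePi_eq_coinMeasure _ e hfair
  have : Countable (spectrum ℝ a) := e.injective.countable
  have hmeas : Measurable fun (x : ℕ → spectrum ℝ a) n => e (x n) :=
    measurable_pi_lambda _ fun n => (measurable_of_countable e).comp (measurable_pi_apply n)
  refine ae_of_ae_map (p := fun y => QuantumCoin.OneRandom y ∧ QuantumCoin.BorelNormal y ∧
    ¬ Computable y ∧ QuantumCoin.ContainsAllInfinitelyOften y) hmeas.aemeasurable ?_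
  rw [hmap]
  filter_upwards [QuantumCoin.ae_oneRandom, QuantumCoin.ae_borelNormal,
    QuantumCoin.ae_not_computable] with y h₁ h₂ h₃
  exact ⟨h₁, h₂, h₃, h₂.containsAllInfinitelyOften⟩
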